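/- Let $d \ge 0$ be an integer and let $\mathcal{T}\colon\mathbb{R}^d\to\mathbb{R}^d$ be a linear operator. Put $$H(\mathcal{T})=\prod_{i=1}^d\bigl(1+|\lambda_i|\bigr),$$ where $\lambda_1,\dots,\lambda_d\in\mathbb{C}$ are the complex eigenvalues of $\mathcal{T}$, listed with algebraic multiplicities. Let $\mu_*$ denote the inner Lebesgue measure on $\mathbb{R}^d$, that is, $\mu_*(A)=\sup\{\mu(B): B\subseteq A,\ B \text{ measurable}\}\in[0,\infty]$ for every $A\subseteq\mathbb{R}^d$, where $\mu$ is the Lebesgue measure. Then for every set $K\subseteq\mathbb{R}^d$ (not assumed measurable), $$\mu_*(K+\mathcal{T}K)\ \ge\ H(\mathcal{T})\cdot\mu_*(K),$$ where $K+\mathcal{T}K=\{x+\mathcal{T}y : x,y\in K\}$. -/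

import Mathlib

open MeasureTheory

open scoped Pointwise

/-- The inner measure `μ_*(A)` of an arbitrary set `A`: the supremum of the measures of the
measurable sets contained in `A`. -/
noncomputable def innerMeasure {α : Type*} [MeasurableSpace α] (μ : Measure α) (A : Set α) :
    ENNReal :=
  ⨆ (B : Set α) (_ : B ⊆ A) (_ : MeasurableSet B), μ B

/-- `H(T) = ∏ (1 + |λ_i|)` over the complex eigenvalues `λ_i` of the real operator `T`, listed with
algebraic multiplicities, that is, over the multiset of complex roots of its characteristic
polynomial. -/
noncomputable def eigenvalueHeight {d : ℕ}
    (T : EuclideanSpace ℝ (Fin d) →ₗ[ℝ] EuclideanSpace ℝ (Fin d)) : ℝ :=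
  ((T.charpoly.aroots ℂ).map (fun z : ℂ => 1 + ‖z‖)).prod

/-! Inner regularity reduces the claim to compact `K`, which is handled by induction on dimension.
Choose a `T`-invariant `W` of dimension 1, or of dimension 2 with no real eigenvalue, and a
complement `V`. On `V × W`, `T` is block triangular with diagonal blocks `P`, `Q`, and `H(T) = H(P)
H(Q)`. On `W` all eigenvalues have the same modulus, so Brunn–Minkowski already gives `|A + QB| ≥
H(Q) min(|A|, |B|)`. If the sections of `K` over `x` and `y` both exceed `t`, the section of `K +
TK` over `x + Py` therefore exceeds `H(Q) t`. Applying the induction hypothesis for `P` to the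
superlevel sets and integrating over `t` gives the factor `H(P) H(Q)`
(`eigenvalueHeight_blockTriangular_mul_le`). -/

theorem IsCompact.preimage_prodMk {X Y : Type*} [TopologicalSpace X] [T2Space X]
    [TopologicalSpace Y] [T2Space Y] {K : Set (X × Y)} (hK : IsCompact K) (x : X) :
    IsCompact (Prod.mk x ⁻¹' K) := by
  refine (hK.image continuous_snd).of_isClosed_subset
    (hK.isClosed.preimage (Continuous.prodMk_right x)) ?_
  intro y hy
  exact ⟨(x, y), hy, rfl⟩

theorem measurable_measureReal_prodMk {X Y : Type*} [TopologicalSpace X] [T2Space X]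
    [MeasurableSpace X] [BorelSpace X] [TopologicalSpace Y] [T2Space Y] [SecondCountableTopology Y]
    [MeasurableSpace Y] [BorelSpace Y]
    (ν : Measure Y) [SFinite ν] {K : Set (X × Y)}
    (hK : IsCompact K) : Measurable fun x => ν.real (Prod.mk x ⁻¹' K) :=
  (measurable_measure_prodMk_left hK.measurableSet).ennreal_toReal

/-- The layer cake formula for the measure of a compact subset of a product, in terms of the
superlevel sets of the measures of its sections, at scale `c`. -/
theorem prod_eq_lintegral_superlevel {X Y : Type*} [TopologicalSpace X] [T2Space X]
    [MeasurableSpace X] [BorelSpace X] [TopologicalSpace Y] [T2Space Y] [SecondCountableTopology Y]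
    [MeasurableSpace Y] [BorelSpace Y]
    (μ : Measure X) (ν : Measure Y) [SFinite ν]
    [IsFiniteMeasureOnCompacts ν] {K : Set (X × Y)} (hK : IsCompact K) {c : ℝ} (hc : 0 < c) :
    (μ.prod ν) K =
      ENNReal.ofReal c * ∫⁻ t in Set.Ioi (0 : ℝ), μ {x | c * t < ν.real (Prod.mk x ⁻¹' K)} := by
  have hm := measurable_measureReal_prodMk ν hK
  have hlayer := lintegral_eq_lintegral_meas_lt (f := fun x => ν.real (Prod.mk x ⁻¹' K) / c) μ
    (Filter.Eventually.of_forall fun x => by positivity) (hm.div_const c).aemeasurable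
  have hset : ∀ t : ℝ, {x | t < ν.real (Prod.mk x ⁻¹' K) / c}
      = {x | c * t < ν.real (Prod.mk x ⁻¹' K)} := by
    intro t
    ext x
    simp only [Set.mem_ofPred_eq, lt_div_iff₀ hc, mul_comm c t]
  simp only [hset] at hlayer
  rw [← hlayer, ← lintegral_const_mul _ (hm.div_const c).ennreal_ofReal,
    Measure.prod_apply hK.measurableSet]
  refine lintegral_congr fun x => ?_
  rw [← ENNReal.ofReal_mul hc.le, mul_div_cancel₀ _ hc.ne', Measure.real,
    ENNReal.ofReal_toReal (hK.preimage_prodMk x).measure_ne_top]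

theorem bddAbove_range_measureReal_prodMk {X Y : Type*} [TopologicalSpace X]
    [TopologicalSpace Y] [MeasurableSpace Y] (ν : Measure Y)
    [IsFiniteMeasureOnCompacts ν] {K : Set (X × Y)} (hK : IsCompact K) :
    BddAbove (Set.range fun x => ν.real (Prod.mk x ⁻¹' K)) := by
  refine ⟨ν.real (Prod.snd '' K), ?_⟩
  rintro _ ⟨x, rfl⟩
  refine measureReal_mono ?_ (hK.image continuous_snd).measure_ne_top
  intro y hy
  exact ⟨(x, y), hy, rfl⟩

/-! ### Brunn–Minkowski in dimensions one and two. -/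

/-- The one-dimensional Brunn–Minkowski inequality for compact sets. -/
theorem Real.volume_add_le_of_isCompact {A B : Set ℝ} (hA : IsCompact A) (hB : IsCompact B)
    (hA0 : A.Nonempty) (hB0 : B.Nonempty) : volume A + volume B ≤ volume (A + B) := by
  obtain ⟨a, haA, ha⟩ := hA.exists_isGreatest hA0
  obtain ⟨b, hbB, hb⟩ := hB.exists_isLeast hB0
  -- With `a = max A` and `b = min B`, the two translates lie on opposite sides of `a + b`.
  have hsub : (b +ᵥ A) ∪ (a +ᵥ B) ⊆ A + B := by
    rintro _ (⟨x, hx, rfl⟩ | ⟨x, hx, rfl⟩)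
    · exact ⟨x, hx, b, hbB, add_comm _ _⟩
    · exact ⟨a, haA, x, hx, rfl⟩
  have hint : (b +ᵥ A) ∩ (a +ᵥ B) ⊆ {a + b} := by
    rintro _ ⟨⟨x, hx, rfl⟩, ⟨y, hy, hxy⟩⟩
    have h1 := ha hx
    have h2 := hb hy
    simp only [vadd_eq_add, Set.mem_singleton_iff] at hxy ⊢
    linarith
  calc volume A + volume B = volume (b +ᵥ A) + volume (a +ᵥ B) := by simp
    _ = volume ((b +ᵥ A) ∪ (a +ᵥ B)) + volume ((b +ᵥ A) ∩ (a +ᵥ B)) :=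
        (measure_union_add_inter _ (hB.vadd a).measurableSet).symm
    _ = volume ((b +ᵥ A) ∪ (a +ᵥ B)) := by
        rw [measure_mono_null hint (measure_singleton _), add_zero]
    _ ≤ volume (A + B) := measure_mono hsub

/-- Inner regularity of a measurable set, using nonempty compact subsets only. -/
theorem MeasurableSet.measure_le_iSup_nonempty_isCompact {X : Type*} [TopologicalSpace X]
    [MeasurableSpace X] {μ : Measure X} [μ.InnerRegular] {A : Set X} (hA : MeasurableSet A) :
    μ A ≤ ⨆ K : {K : Set X // K ⊆ A ∧ IsCompact K ∧ K.Nonempty}, μ K := by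
  rw [hA.measure_eq_iSup_isCompact]
  refine iSup₂_le fun K hK => iSup_le fun hKc => ?_
  rcases K.eq_empty_or_nonempty with rfl | hne
  · simp
  · exact le_iSup (fun K : {K : Set X // K ⊆ A ∧ IsCompact K ∧ K.Nonempty} => μ K)
      ⟨K, hK, hKc, hne⟩

/-- Needed for superlevel sets, which are measurable but need not be compact. -/
theorem Real.volume_add_le {A B : Set ℝ} (hA : MeasurableSet A) (hB : MeasurableSet B)
    (hA0 : A.Nonempty) (hB0 : B.Nonempty) : volume A + volume B ≤ volume (A + B) := by
  have hne : ∀ {S : Set ℝ}, S.Nonempty →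
      Nonempty {K : Set ℝ // K ⊆ S ∧ IsCompact K ∧ K.Nonempty} := fun ⟨x, hx⟩ =>
    ⟨⟨{x}, by simpa using hx, isCompact_singleton, Set.singleton_nonempty x⟩⟩
  have := hne hA0
  have := hne hB0
  refine (add_le_add (hA.measure_le_iSup_nonempty_isCompact)
    (hB.measure_le_iSup_nonempty_isCompact)).trans ?_
  refine ENNReal.iSup_add_iSup_le fun P Q => ?_
  exact (Real.volume_add_le_of_isCompact P.2.2.1 Q.2.2.1 P.2.2.2 Q.2.2.2).trans
    (measure_mono (Set.add_subset_add P.2.1 Q.2.1))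

theorem preimage_prodMk_add_subset {X Y : Type*} [Add X] [Add Y] (A B : Set (X × Y)) (x y : X) :
    Prod.mk x ⁻¹' A + Prod.mk y ⁻¹' B ⊆ Prod.mk (x + y) ⁻¹' (A + B) := by
  rintro _ ⟨a, ha, b, hb, rfl⟩
  exact ⟨(x, a), ha, (y, b), hb, rfl⟩

/-- The two-dimensional Brunn–Minkowski inequality for compact sets of positive measure. -/
theorem Real.sq_sqrt_volume_add_le {A B : Set (ℝ × ℝ)} (hA : IsCompact A) (hB : IsCompact B)
    (hA0 : volume A ≠ 0) (hB0 : volume B ≠ 0) :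
    (√(volume.real A) + √(volume.real B)) ^ 2 ≤ volume.real (A + B) := by
  -- `F` is the largest section length (a supremum). Rescaling levels by it makes the superlevel
  -- sets of both bodies nonempty for all `t < 1`, as one-dimensional Brunn–Minkowski requires, and
  -- empty for `t ≥ 1`.
  have key : ∀ {S : Set (ℝ × ℝ)}, IsCompact S → volume S ≠ 0 → ∃ F : ℝ, 0 < F ∧
      (∀ t < 1, ({x | F * t < volume.real (Prod.mk x ⁻¹' S)} : Set ℝ).Nonempty) ∧
      volume.real S = F * (∫⁻ t in Set.Ioo (0 : ℝ) 1,
        volume {x | F * t < volume.real (Prod.mk x ⁻¹' S)}).toReal ∧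
      (∫⁻ t in Set.Ioo (0 : ℝ) 1, volume {x | F * t < volume.real (Prod.mk x ⁻¹' S)}) ≠ ⊤ := by
    intro S hS hS0
    have hbdd := bddAbove_range_measureReal_prodMk (volume : Measure ℝ) hS
    set F := ⨆ x, volume.real (Prod.mk x ⁻¹' S) with hF
    have hle : ∀ x, volume.real (Prod.mk x ⁻¹' S) ≤ F := fun x => le_ciSup hbdd x
    have hF0 : 0 < F := by
      by_contra hcon
      apply hS0
      rw [Measure.volume_eq_prod, prod_eq_lintegral_superlevel _ _ hS one_pos]
      have : ∀ t ∈ Set.Ioi (0 : ℝ),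
          volume {x | 1 * t < volume.real (Prod.mk x ⁻¹' S)} = 0 := by
        intro t ht
        convert measure_empty (μ := (volume : Measure ℝ))
        ext x
        have h1 := hle x
        have h2 : (0 : ℝ) < t := ht
        simp only [Set.mem_ofPred_eq, Set.mem_empty_iff_false, iff_false, not_lt]
        linarith
      rw [setLIntegral_congr_fun measurableSet_Ioi this]
      simp
    have heq : ∫⁻ t in Set.Ioi (0 : ℝ), volume {x | F * t < volume.real (Prod.mk x ⁻¹' S)}
        = ∫⁻ t in Set.Ioo (0 : ℝ) 1, volume {x | F * t < volume.real (Prod.mk x ⁻¹' S)} := by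
      rw [← lintegral_inter_add_sdiff _ (Set.Ioi (0 : ℝ)) (measurableSet_Ioo (a := (0 : ℝ)) (b := 1)),
        Set.inter_eq_self_of_subset_right Set.Ioo_subset_Ioi_self]
      convert add_zero _
      refine (setLIntegral_congr_fun (g := fun _ => 0)
        (measurableSet_Ioi.diff measurableSet_Ioo) ?_).trans lintegral_zero
      rintro t ⟨ht0, ht1⟩
      have ht : 1 ≤ t := by
        by_contra hcon
        exact ht1 ⟨ht0, not_le.1 hcon⟩
      convert measure_empty (μ := (volume : Measure ℝ))
      ext x
      simp only [Set.mem_ofPred_eq, Set.mem_empty_iff_false, iff_false, not_lt]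
      nlinarith [hle x]
    have hvol := prod_eq_lintegral_superlevel volume volume hS hF0
    rw [heq, ← Measure.volume_eq_prod] at hvol
    refine ⟨F, hF0, fun t ht => ?_, ?_, fun htop => ?_⟩
    · exact exists_lt_of_lt_ciSup (by nlinarith : F * t < F)
    · rw [Measure.real, hvol, ENNReal.toReal_mul, ENNReal.toReal_ofReal hF0.le]
    · rw [htop, ENNReal.mul_top (by simpa using hF0)] at hvol
      exact hS.measure_ne_top hvol
  obtain ⟨F, hF0, hFne, hFv, hFt⟩ := key hA hA0
  obtain ⟨G, hG0, hGne, hGv, hGt⟩ := key hB hB0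
  have hFG : 0 < F + G := add_pos hF0 hG0
  set I := ∫⁻ t in Set.Ioo (0 : ℝ) 1, volume {x | F * t < volume.real (Prod.mk x ⁻¹' A)}
  set J := ∫⁻ t in Set.Ioo (0 : ℝ) 1, volume {x | G * t < volume.real (Prod.mk x ⁻¹' B)}
  have hAm := measurable_measureReal_prodMk (volume : Measure ℝ) hA
  have hBm := measurable_measureReal_prodMk (volume : Measure ℝ) hB
  have hAB := hA.add hB
  -- Brunn–Minkowski is used twice: on sections, so that levels `F t` and `G t` add to `(F + G) t`,
  -- and on the superlevel sets themselves.
  have hmain : ENNReal.ofReal (F + G) * (I + J) ≤ volume (A + B) := by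
    rw [Measure.volume_eq_prod, prod_eq_lintegral_superlevel volume volume hAB hFG]
    gcongr
    refine le_trans ?_ (lintegral_mono_set (s := Set.Ioo (0 : ℝ) 1) Set.Ioo_subset_Ioi_self)
    refine (le_lintegral_add _ _).trans ?_
    refine setLIntegral_mono' measurableSet_Ioo fun t ht => ?_
    refine (Real.volume_add_le (measurableSet_lt measurable_const hAm)
      (measurableSet_lt measurable_const hBm) (hFne t ht.2) (hGne t ht.2)).trans
      (measure_mono ?_)
    rintro _ ⟨x, hx, y, hy, rfl⟩
    have hxc := hA.preimage_prodMk x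
    have hyc := hB.preimage_prodMk y
    have hpos : ∀ {S : Set ℝ} {c : ℝ}, 0 < c → c * t < volume.real S → S.Nonempty := by
      intro S c hc h
      rw [Set.nonempty_iff_ne_empty]
      rintro rfl
      have := mul_pos hc ht.1
      simp only [measureReal_empty] at h
      linarith
    have h1 := (Real.volume_add_le_of_isCompact hxc hyc (hpos hF0 hx) (hpos hG0 hy)).trans
      (measure_mono (preimage_prodMk_add_subset A B x y))
    have h2 := ENNReal.toReal_mono (hAB.preimage_prodMk (x + y)).measure_ne_top h1
    rw [ENNReal.toReal_add hxc.measure_ne_top hyc.measure_ne_top] at h2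
    simp only [Set.mem_ofPred_eq] at hx hy ⊢
    simp only [Measure.real] at hx hy ⊢
    linarith
  have hreal := ENNReal.toReal_mono hAB.measure_ne_top hmain
  rw [ENNReal.toReal_mul, ENNReal.toReal_ofReal hFG.le, ENNReal.toReal_add hFt hGt] at hreal
  refine le_trans ?_ hreal
  rw [hFv, hGv]
  have hI : 0 ≤ I.toReal := ENNReal.toReal_nonneg
  have hJ : 0 ≤ J.toReal := ENNReal.toReal_nonneg
  have hsI := Real.sq_sqrt (mul_nonneg hF0.le hI)
  have hsJ := Real.sq_sqrt (mul_nonneg hG0.le hJ)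
  -- AM–GM on the cross terms of `(F + G)(I + J)`.
  have hcross : 2 * (√(F * I.toReal) * √(G * J.toReal)) ≤ F * J.toReal + G * I.toReal := by
    rw [← Real.sqrt_mul (by positivity),
      show F * I.toReal * (G * J.toReal) = (F * J.toReal) * (G * I.toReal) by ring,
      Real.sqrt_mul (by positivity)]
    have h1 := Real.sq_sqrt (mul_nonneg hF0.le hJ)
    have h2 := Real.sq_sqrt (mul_nonneg hG0.le hI)
    nlinarith [sq_nonneg (√(F * J.toReal) - √(G * I.toReal))]
  nlinarith

/-! ### Eigenvalue heights and invariant subspaces. -/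

section Height

open Polynomial

/-- `∏ (1 + |λ|)` over the complex eigenvalues `λ` of an endomorphism of a finite-dimensional real
vector space, with algebraic multiplicities. -/
noncomputable def LinearMap.eigenvalueHeight {E : Type*} [AddCommGroup E] [Module ℝ E]
    [FiniteDimensional ℝ E] (T : E →ₗ[ℝ] E) : ℝ :=
  ((T.charpoly.aroots ℂ).map (fun z : ℂ => 1 + ‖z‖)).prod

variable {E F : Type*} [AddCommGroup E] [Module ℝ E] [FiniteDimensional ℝ E]
  [AddCommGroup F] [Module ℝ F] [FiniteDimensional ℝ F]

theorem LinearMap.eigenvalueHeight_pos (T : E →ₗ[ℝ] E) : 0 < T.eigenvalueHeight := by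
  refine Multiset.prod_induction (fun x : ℝ => 0 < x) _ (fun _ _ => mul_pos) one_pos ?_
  intro x hx
  obtain ⟨z, -, rfl⟩ := Multiset.mem_map.1 hx
  positivity

theorem LinearMap.eigenvalueHeight_conj (e : E ≃ₗ[ℝ] F) (T : E →ₗ[ℝ] E) :
    LinearMap.eigenvalueHeight (e.conj T) = T.eigenvalueHeight := by
  rw [LinearMap.eigenvalueHeight, LinearEquiv.charpoly_conj, LinearMap.eigenvalueHeight]

theorem LinearMap.eigenvalueHeight_of_subsingleton [Subsingleton E] (T : E →ₗ[ℝ] E) :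
    T.eigenvalueHeight = 1 := by
  have h : T.charpoly = 1 := by
    rw [← T.charpoly_monic.natDegree_eq_zero, LinearMap.charpoly_natDegree,
      Module.finrank_zero_of_subsingleton]
  simp [LinearMap.eigenvalueHeight, h]

/-- The block triangular endomorphism `(v, w) ↦ (P v, S v + Q w)` of `E × F`. -/
def LinearMap.blockTriangular (P : E →ₗ[ℝ] E) (S : E →ₗ[ℝ] F) (Q : F →ₗ[ℝ] F) :
    E × F →ₗ[ℝ] E × F :=
  (P ∘ₗ LinearMap.fst ℝ E F).prod (S.coprod Q)

theorem LinearMap.charpoly_blockTriangular (P : E →ₗ[ℝ] E) (S : E →ₗ[ℝ] F) (Q : F →ₗ[ℝ] F) :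
    (LinearMap.blockTriangular P S Q).charpoly = P.charpoly * Q.charpoly := by
  let b := Module.finBasis ℝ E
  let c := Module.finBasis ℝ F
  have h : LinearMap.toMatrix (b.prod c) (b.prod c) (LinearMap.blockTriangular P S Q) =
      Matrix.fromBlocks (LinearMap.toMatrix b b P) 0 (LinearMap.toMatrix b c S)
        (LinearMap.toMatrix c c Q) := by
    ext (i | i) (j | j) <;>
      simp [LinearMap.toMatrix_apply, LinearMap.blockTriangular]
  rw [← LinearMap.charpoly_toMatrix _ (b.prod c), h, Matrix.charpoly_fromBlocks_zero₁₂,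
    LinearMap.charpoly_toMatrix, LinearMap.charpoly_toMatrix]

theorem LinearMap.eigenvalueHeight_blockTriangular (P : E →ₗ[ℝ] E) (S : E →ₗ[ℝ] F)
    (Q : F →ₗ[ℝ] F) : (LinearMap.blockTriangular P S Q).eigenvalueHeight =
      P.eigenvalueHeight * Q.eigenvalueHeight := by
  simp only [LinearMap.eigenvalueHeight]
  rw [LinearMap.charpoly_blockTriangular,
    aroots_mul (mul_ne_zero P.charpoly_monic.ne_zero Q.charpoly_monic.ne_zero),
    Multiset.map_add, Multiset.prod_add]

theorem LinearMap.eigenvalueHeight_of_finrank_eq_one (hE : Module.finrank ℝ E = 1)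
    (T : E →ₗ[ℝ] E) : T.eigenvalueHeight = 1 + |LinearMap.det T| := by
  have h : T.charpoly = X - C (LinearMap.det T) := by
    rw [T.charpoly_monic.eq_X_add_C (by rw [LinearMap.charpoly_natDegree, hE]),
      LinearMap.det_eq_sign_charpoly_coeff, hE]
    simp
  simp [LinearMap.eigenvalueHeight, h]

/-- The roots form a conjugate pair, so the determinant is the square of their common modulus. -/
theorem LinearMap.eigenvalueHeight_of_finrank_eq_two (hE : Module.finrank ℝ E = 2)
    (T : E →ₗ[ℝ] E) (hT : ∀ a : ℝ, ¬ T.charpoly.IsRoot a) :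
    T.eigenvalueHeight = (1 + √|LinearMap.det T|) ^ 2 ∧ LinearMap.det T ≠ 0 := by
  have hmon := T.charpoly_monic
  have hmonC : (T.charpoly.map (algebraMap ℝ ℂ)).Monic := hmon.map _
  have hdeg : (T.charpoly.map (algebraMap ℝ ℂ)).natDegree = 2 := by
    rw [natDegree_map, LinearMap.charpoly_natDegree, hE]
  obtain ⟨z, hz⟩ := IsAlgClosed.exists_root (T.charpoly.map (algebraMap ℝ ℂ)) (by
    rw [degree_eq_natDegree hmonC.ne_zero, hdeg]; norm_num)
  have hz0 : aeval z T.charpoly = 0 := by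
    rwa [IsRoot, eval_map_algebraMap] at hz
  have hz1 : aeval (starRingEnd ℂ z) T.charpoly = 0 := by
    rw [aeval_conj, hz0, map_zero]
  have hne : z ≠ starRingEnd ℂ z := by
    intro h
    obtain ⟨a, rfl⟩ := Complex.conj_eq_iff_real.1 h.symm
    refine hT a ?_
    rw [← Complex.coe_algebraMap, aeval_algebraMap_apply] at hz0
    simpa using hz0
  have hroots : T.charpoly.aroots ℂ = {z, starRingEnd ℂ z} := by
    symm
    refine Multiset.eq_of_le_of_card_le ?_ ?_
    · rw [Multiset.le_iff_subset (by simpa using hne)]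
      intro w hw
      rw [mem_aroots]
      refine ⟨hmon.ne_zero, ?_⟩
      rcases Multiset.mem_cons.1 hw with rfl | hw
      · exact hz0
      · rw [Multiset.mem_singleton.1 hw]; exact hz1
    · simpa [aroots, hdeg] using card_roots' (T.charpoly.map (algebraMap ℝ ℂ))
  have hdet : LinearMap.det T = ‖z‖ ^ 2 := by
    have hsplit := IsAlgClosed.splits (T.charpoly.map (algebraMap ℝ ℂ))
    have h := hsplit.coeff_zero_eq_prod_roots_of_monic hmonC
    rw [hdeg, ← aroots, hroots, coeff_map] at h
    have h2 := LinearMap.det_eq_sign_charpoly_coeff T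
    rw [hE] at h2
    simp only [even_two, Even.neg_pow, one_pow, one_mul] at h2
    rw [h2]
    apply Complex.ofReal_injective
    simpa [Complex.mul_conj'] using h
  have hzne : z ≠ 0 := by
    rintro rfl
    simp at hne
  refine ⟨?_, by rw [hdet]; positivity⟩
  rw [LinearMap.eigenvalueHeight, hroots, hdet, abs_of_nonneg (by positivity),
    Real.sqrt_sq (norm_nonneg z)]
  simp [sq]

/-- A nonzero real endomorphism either has an eigenvector or preserves a plane on which it has no
eigenvector. -/
theorem LinearMap.exists_invariant_finrank_le_two [Nontrivial E] (T : E →ₗ[ℝ] E) :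
    ∃ W : Submodule ℝ E, ∃ hW : ∀ x ∈ W, T x ∈ W, Module.finrank ℝ W = 1 ∨
      Module.finrank ℝ W = 2 ∧ ∀ a : ℝ, ¬ (T.restrict hW).charpoly.IsRoot a := by
  by_cases hev : ∃ a : ℝ, ∃ v : E, v ≠ 0 ∧ T v = a • v
  · obtain ⟨a, v, hv, hTv⟩ := hev
    refine ⟨ℝ ∙ v, fun x hx => ?_, Or.inl (finrank_span_singleton hv)⟩
    obtain ⟨c, rfl⟩ := Submodule.mem_span_singleton.1 hx
    rw [map_smul, hTv]
    exact Submodule.smul_mem _ _ (Submodule.smul_mem _ _ (Submodule.mem_span_singleton_self v))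
  · have hint : IsIntegral ℝ T := Algebra.IsIntegral.isIntegral T
    have hunit : ¬ IsUnit (minpoly ℝ T) := minpoly.not_isUnit ℝ T
    -- A real irreducible `p` has degree at most 2. By minimality `q(T) ≠ 0`, so some nonzero `v =
    -- q(T) u` is killed by `p(T)`, and `v`, `T v` span the plane.
    obtain ⟨p, hp, q, hpq⟩ := WfDvdMonoid.exists_irreducible_factor hunit (minpoly.ne_zero hint)
    have hq0 : q ≠ 0 := by
      rintro rfl
      exact minpoly.ne_zero hint (by rw [hpq, mul_zero])
    have hqT : aeval T q ≠ 0 := by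
      intro h
      have hdvd := minpoly.dvd ℝ T h
      have h2 := natDegree_le_of_dvd hdvd hq0
      rw [hpq, natDegree_mul hp.ne_zero hq0] at h2
      have h3 := hp.natDegree_pos
      omega
    obtain ⟨u, hu⟩ : ∃ u, aeval T q u ≠ 0 := by
      by_contra! hcon
      exact hqT (LinearMap.ext hcon)
    set v := aeval T q u
    have hpv : aeval T p v = 0 := by
      have h := minpoly.aeval ℝ T
      rw [hpq, map_mul] at h
      exact LinearMap.congr_fun h u
    have hp2 : p.natDegree ≤ 2 := hp.natDegree_le_two
    have hsum : p.coeff 0 • v + p.coeff 1 • T v + p.coeff 2 • T (T v) = 0 := by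
      rw [aeval_eq_sum_range' (n := 3) (by omega)] at hpv
      simpa [Finset.sum_range_succ, pow_succ] using hpv
    have hvW : v ∈ Submodule.span ℝ {v, T v} := Submodule.subset_span (by simp)
    have hTvW : T v ∈ Submodule.span ℝ {v, T v} := Submodule.subset_span (by simp)
    have hc2 : p.coeff 2 ≠ 0 := by
      intro h2
      rw [h2, zero_smul, add_zero] at hsum
      by_cases h1 : p.coeff 1 = 0
      · rw [h1, zero_smul, add_zero] at hsum
        have h0 : p.coeff 0 = 0 := (smul_eq_zero.1 hsum).resolve_right hu
        refine hp.ne_zero (Polynomial.ext fun n => ?_)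
        rcases n with _ | _ | _ | n
        · simpa using h0
        · simpa using h1
        · simpa using h2
        · rw [coeff_eq_zero_of_natDegree_lt (by omega), coeff_zero]
      · refine hev ⟨-(p.coeff 1)⁻¹ * p.coeff 0, v, hu, ?_⟩
        have := congrArg (fun x => (p.coeff 1)⁻¹ • x) hsum
        simp only [smul_add, smul_smul, inv_mul_cancel₀ h1, one_smul, smul_zero] at this
        rw [neg_mul, neg_smul]
        exact eq_neg_of_add_eq_zero_right this
    have hTTv : T (T v) ∈ Submodule.span ℝ {v, T v} := by
      have := eq_neg_of_add_eq_zero_right hsum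
      rw [← inv_smul_smul₀ hc2 (T (T v)), this]
      exact Submodule.smul_mem _ _ (Submodule.neg_mem _ (Submodule.add_mem _
        (Submodule.smul_mem _ _ hvW) (Submodule.smul_mem _ _ hTvW)))
    have hW : ∀ x ∈ Submodule.span ℝ {v, T v}, T x ∈ Submodule.span ℝ {v, T v} := by
      intro x hx
      obtain ⟨a, b, rfl⟩ := Submodule.mem_span_pair.1 hx
      rw [map_add, map_smul, map_smul]
      exact Submodule.add_mem _ (Submodule.smul_mem _ _ hTvW) (Submodule.smul_mem _ _ hTTv)
    refine ⟨Submodule.span ℝ {v, T v}, hW, Or.inr ⟨?_, fun a ha => ?_⟩⟩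
    · have hli : LinearIndependent ℝ ![v, T v] := by
        rw [LinearIndependent.pair_iff' hu]
        exact fun a h => hev ⟨a, v, hu, h.symm⟩
      have := finrank_span_eq_card hli
      rwa [Matrix.range_cons_cons_empty, Fintype.card_fin] at this
    · rw [← Module.End.hasEigenvalue_iff_isRoot_charpoly] at ha
      obtain ⟨w, hw⟩ := ha.exists_hasEigenvector
      exact hev ⟨a, w, by simpa using hw.2, congrArg Subtype.val hw.apply_eq_smul⟩

end Height

/-! ### Estimates on the invariant subspace and the block triangular step. -/

section Transfer

variable {E F : Type*} [NormedAddCommGroup E] [NormedSpace ℝ E]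
  [MeasurableSpace E] [BorelSpace E] [NormedAddCommGroup F] [NormedSpace ℝ F]
  [FiniteDimensional ℝ F] [MeasurableSpace F] [BorelSpace F]

theorem ContinuousLinearEquiv.exists_addHaar_eq_mul_image (L : E ≃L[ℝ] F) (μ : Measure E)
    [μ.IsAddHaarMeasure] (ν : Measure F) [ν.IsAddHaarMeasure] :
    ∃ c : NNReal, ∀ s : Set E, μ s = c * ν (L '' s) := by
  have := L.isAddHaarMeasure_map μ
  refine ⟨(μ.map L).addHaarScalarFactor ν, fun s => ?_⟩
  have h : (μ.map L) (L '' s) = μ s := by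
    refine (L.toHomeomorph.measurableEmbedding.map_apply μ _).trans ?_
    exact congrArg μ (Set.preimage_image_eq s L.injective)
  rw [← h]
  exact congrArg (fun m : Measure F => m (L '' s)) (Measure.isAddLeftInvariant_eq_smul (μ.map L) ν)

variable [FiniteDimensional ℝ E]

theorem addHaar_add_le_of_finrank_eq_one (hE : Module.finrank ℝ E = 1) (μ : Measure E)
    [μ.IsAddHaarMeasure] {A B : Set E} (hA : IsCompact A) (hB : IsCompact B)
    (hA0 : A.Nonempty) (hB0 : B.Nonempty) : μ A + μ B ≤ μ (A + B) := by
  let L : E ≃L[ℝ] ℝ := ContinuousLinearEquiv.ofFinrankEq (by rw [hE, Module.finrank_self])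
  obtain ⟨c, hc⟩ := L.exists_addHaar_eq_mul_image μ volume
  rw [hc, hc, hc, ← mul_add, Set.image_add]
  gcongr
  exact Real.volume_add_le_of_isCompact (hA.image L.continuous) (hB.image L.continuous)
    (hA0.image L) (hB0.image L)

theorem sq_sqrt_addHaar_add_le_of_finrank_eq_two (hE : Module.finrank ℝ E = 2) (μ : Measure E)
    [μ.IsAddHaarMeasure] {A B : Set E} (hA : IsCompact A) (hB : IsCompact B)
    (hA0 : μ A ≠ 0) (hB0 : μ B ≠ 0) :
    (√(μ.real A) + √(μ.real B)) ^ 2 ≤ μ.real (A + B) := by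
  let L : E ≃L[ℝ] ℝ × ℝ := ContinuousLinearEquiv.ofFinrankEq (by simp [hE])
  have : (volume : Measure (ℝ × ℝ)).IsAddHaarMeasure := by
    rw [Measure.volume_eq_prod]; infer_instance
  obtain ⟨c, hc⟩ := L.exists_addHaar_eq_mul_image μ volume
  have hr : ∀ s, μ.real s = c * (volume : Measure (ℝ × ℝ)).real (L '' s) := by
    intro s
    simp [Measure.real, hc]
  have h := Real.sq_sqrt_volume_add_le (hA.image L.continuous) (hB.image L.continuous)
    (fun h => hA0 (by rw [hc, h, mul_zero])) (fun h => hB0 (by rw [hc, h, mul_zero]))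
  rw [hr, hr, hr, Set.image_add, Real.sqrt_mul c.coe_nonneg, Real.sqrt_mul c.coe_nonneg, ← mul_add, mul_pow,
    Real.sq_sqrt c.coe_nonneg]
  gcongr

/-- Two sets are allowed because sections over different base points are compared. -/
theorem eigenvalueHeight_mul_min_le_of_finrank_eq_one (hE : Module.finrank ℝ E = 1)
    (T : E →ₗ[ℝ] E) (μ : Measure E) [μ.IsAddHaarMeasure] {A B : Set E} (hA : IsCompact A)
    (hB : IsCompact B) :
    ENNReal.ofReal T.eigenvalueHeight * min (μ A) (μ B) ≤ μ (A + T '' B) := by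
  rcases A.eq_empty_or_nonempty with rfl | hA0
  · simp
  rcases B.eq_empty_or_nonempty with rfl | hB0
  · simp
  refine le_trans ?_ (addHaar_add_le_of_finrank_eq_one hE μ hA
    (hB.image T.continuous_of_finiteDimensional) hA0 (hB0.image T))
  rw [T.eigenvalueHeight_of_finrank_eq_one hE, Measure.addHaar_image_linearMap,
    ENNReal.ofReal_add zero_le_one (abs_nonneg _), add_mul, ENNReal.ofReal_one, one_mul]
  gcongr
  · exact min_le_left _ _
  · exact min_le_right _ _

theorem eigenvalueHeight_mul_min_le_of_finrank_eq_two (hE : Module.finrank ℝ E = 2)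
    (T : E →ₗ[ℝ] E) (hT : ∀ a : ℝ, ¬ T.charpoly.IsRoot a) (μ : Measure E) [μ.IsAddHaarMeasure]
    {A B : Set E} (hA : IsCompact A) (hB : IsCompact B) :
    ENNReal.ofReal T.eigenvalueHeight * min (μ A) (μ B) ≤ μ (A + T '' B) := by
  obtain ⟨hh, hdet⟩ := T.eigenvalueHeight_of_finrank_eq_two hE hT
  by_cases hA0 : μ A = 0
  · simp [hA0]
  by_cases hB0 : μ B = 0
  · simp [hB0]
  have hTB : IsCompact (T '' B) := hB.image T.continuous_of_finiteDimensional
  have himg := Measure.addHaar_image_linearMap μ T B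
  have hTB0 : μ (T '' B) ≠ 0 := by
    rw [himg]
    exact mul_ne_zero (by simpa using hdet) hB0
  have h := sq_sqrt_addHaar_add_le_of_finrank_eq_two hE μ hA hTB hA0 hTB0
  have himg' : μ.real (T '' B) = |LinearMap.det T| * μ.real B := by
    rw [Measure.real, himg, ENNReal.toReal_mul, ENNReal.toReal_ofReal (abs_nonneg _),
      Measure.real]
  have hmin : (min (μ A) (μ B)).toReal = min (μ.real A) (μ.real B) :=
    ENNReal.toReal_min hA.measure_ne_top hB.measure_ne_top
  have hfin : min (μ A) (μ B) ≠ ⊤ := ne_top_of_le_ne_top hA.measure_ne_top (min_le_left _ _)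
  rw [← ENNReal.ofReal_toReal hfin, ← ENNReal.ofReal_mul T.eigenvalueHeight_pos.le,
    ← ENNReal.ofReal_toReal (hA.add hTB).measure_ne_top]
  refine ENNReal.ofReal_le_ofReal (le_trans ?_ h)
  rw [hh, hmin, himg', Real.sqrt_mul (abs_nonneg _)]
  have hm0 : 0 ≤ min (μ.real A) (μ.real B) := le_min measureReal_nonneg measureReal_nonneg
  nth_rewrite 1 [← Real.sq_sqrt hm0]
  rw [← mul_pow, add_mul, one_mul]
  gcongr
  · exact min_le_left _ _
  · exact min_le_right _ _

/-- If `P` expands compact sets by `eigenvalueHeight P`, and `Q` satisfies the corresponding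
estimate for pairs of compact sets, then any block triangular endomorphism with diagonal blocks
`P` and `Q` expands compact sets by its `eigenvalueHeight`. -/
theorem eigenvalueHeight_blockTriangular_mul_le (P : E →ₗ[ℝ] E) (S : E →ₗ[ℝ] F)
    (Q : F →ₗ[ℝ] F) (μ : Measure E) [μ.IsAddHaarMeasure] (ν : Measure F) [ν.IsAddHaarMeasure]
    (hP : ∀ K : Set E, IsCompact K →
      ENNReal.ofReal P.eigenvalueHeight * μ K ≤ μ (K + P '' K))
    (hQ : ∀ A B : Set F, IsCompact A → IsCompact B →
      ENNReal.ofReal Q.eigenvalueHeight * min (ν A) (ν B) ≤ ν (A + Q '' B))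
    {K : Set (E × F)} (hK : IsCompact K) :
    ENNReal.ofReal (LinearMap.blockTriangular P S Q).eigenvalueHeight * (μ.prod ν) K ≤
      (μ.prod ν) (K + LinearMap.blockTriangular P S Q '' K) := by
  set T := LinearMap.blockTriangular P S Q with hTdef
  have hTK : IsCompact (K + T '' K) := hK.add (hK.image T.continuous_of_finiteDimensional)
  have hPmeas : ∀ L : Set E, MeasurableSet L →
      ENNReal.ofReal P.eigenvalueHeight * μ L ≤ μ (L + P '' L) := by
    intro L hL
    rw [hL.measure_eq_iSup_isCompact]
    simp only [ENNReal.mul_iSup]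
    refine iSup₂_le fun C hC => iSup_le fun hCc => (hP C hCc).trans (measure_mono ?_)
    exact Set.add_subset_add hC (Set.image_mono hC)
  -- Scale 1 for `K` against scale `H(Q)` for `K + TK` pairs level `t` with level `H(Q) t` and
  -- produces the factor `H(Q)`.
  rw [prod_eq_lintegral_superlevel μ ν hK one_pos,
    prod_eq_lintegral_superlevel μ ν hTK Q.eigenvalueHeight_pos,
    LinearMap.eigenvalueHeight_blockTriangular, ENNReal.ofReal_mul P.eigenvalueHeight_pos.le,
    ENNReal.ofReal_one, one_mul, mul_comm (ENNReal.ofReal P.eigenvalueHeight), mul_assoc,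
    ← lintegral_const_mul' _ _ ENNReal.ofReal_ne_top]
  gcongr with t
  simp only [one_mul]
  have hlevel : MeasurableSet {x | t < ν.real (Prod.mk x ⁻¹' K)} :=
    measurableSet_lt measurable_const (measurable_measureReal_prodMk ν hK)
  refine (hPmeas _ hlevel).trans (measure_mono ?_)
  rintro _ ⟨x, hx, _, ⟨y, hy, rfl⟩, rfl⟩
  have hxc := hK.preimage_prodMk x
  have hyc := hK.preimage_prodMk y
  simp only [Set.mem_ofPred_eq] at hx hy ⊢
  -- The off-diagonal block only translates sections, so it does not affect measures.
  have hsub : S y +ᵥ (Prod.mk x ⁻¹' K + Q '' (Prod.mk y ⁻¹' K)) ⊆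
      Prod.mk (x + P y) ⁻¹' (K + T '' K) := by
    rintro _ ⟨_, ⟨a, ha, _, ⟨b, hb, rfl⟩, rfl⟩, rfl⟩
    refine ⟨(x, a), ha, T (y, b), ⟨(y, b), hb, rfl⟩, ?_⟩
    simp [hTdef, LinearMap.blockTriangular, add_left_comm]
  have h := (hQ _ _ hxc hyc).trans (le_trans (by simp) (measure_mono (μ := ν) hsub))
  have hr := ENNReal.toReal_mono (hTK.preimage_prodMk (x + P y)).measure_ne_top h
  rw [ENNReal.toReal_mul, ENNReal.toReal_ofReal Q.eigenvalueHeight_pos.le,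
    ENNReal.toReal_min hxc.measure_ne_top hyc.measure_ne_top] at hr
  exact lt_of_lt_of_le (mul_lt_mul_of_pos_left (lt_min hx hy) Q.eigenvalueHeight_pos) hr

end Transfer

/-! ### Induction on dimension and passage to inner measure. -/

/-- A linear endomorphism `T` satisfies `H(T) |K| ≤ |K + T K|` for compact sets `K`. -/
theorem IsCompact.eigenvalueHeight_mul_addHaar_le {E : Type*} [NormedAddCommGroup E]
    [NormedSpace ℝ E] [FiniteDimensional ℝ E] [MeasurableSpace E] [BorelSpace E]
    (T : E →ₗ[ℝ] E) (μ : Measure E) [μ.IsAddHaarMeasure] {K : Set E} (hK : IsCompact K) :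
    ENNReal.ofReal T.eigenvalueHeight * μ K ≤ μ (K + T '' K) := by
  induction hn : Module.finrank ℝ E using Nat.strong_induction_on generalizing E with
  | _ n ih =>
    rcases subsingleton_or_nontrivial E with hE | hE
    · rw [T.eigenvalueHeight_of_subsingleton, ENNReal.ofReal_one, one_mul]
      refine measure_mono fun x hx => ?_
      exact ⟨x, hx, T x, ⟨x, hx, rfl⟩, Subsingleton.elim _ _⟩
    obtain ⟨W, hW, hWdim⟩ := T.exists_invariant_finrank_le_two
    obtain ⟨V, hVW⟩ := W.exists_isCompl
    let e : (V × W) ≃ₗ[ℝ] E := Submodule.prodEquivOfIsCompl V W hVW.symm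
    let L : E ≃L[ℝ] V × W := e.symm.toContinuousLinearEquiv
    let R : V × W →ₗ[ℝ] V × W := e.symm.conj T
    let P : V →ₗ[ℝ] V := LinearMap.fst ℝ V W ∘ₗ R ∘ₗ LinearMap.inl ℝ V W
    let S : V →ₗ[ℝ] W := LinearMap.snd ℝ V W ∘ₗ R ∘ₗ LinearMap.inl ℝ V W
    let Q : W →ₗ[ℝ] W := T.restrict hW
    -- Invariance of `W` kills the block from `W` to `V`.
    have hRW : ∀ w : W, R (0, w) = (0, Q w) := by
      intro w
      apply e.injective
      change e (e.symm (T (e (0, w)))) = e (0, Q w)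
      rw [e.apply_symm_apply]
      simp [Q, e]
    have hR : R = LinearMap.blockTriangular P S Q := by
      refine LinearMap.prod_ext (LinearMap.ext fun v => ?_) (LinearMap.ext fun w => ?_)
      · simp [LinearMap.blockTriangular, P, S]
      · simp [LinearMap.blockTriangular, hRW]
    have hPK : ∀ C : Set V, IsCompact C → ENNReal.ofReal P.eigenvalueHeight *
        (Measure.addHaar : Measure V) C ≤ (Measure.addHaar : Measure V) (C + P '' C) := by
      intro C hC
      refine ih _ ?_ P _ hC rfl
      have hsum := Submodule.finrank_add_eq_of_isCompl hVW
      rcases hWdim with h | ⟨h, -⟩ <;> omega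
    have hQK : ∀ A B : Set W, IsCompact A → IsCompact B → ENNReal.ofReal Q.eigenvalueHeight *
        min ((Measure.addHaar : Measure W) A) ((Measure.addHaar : Measure W) B) ≤
          (Measure.addHaar : Measure W) (A + Q '' B) := by
      intro A B hA hB
      rcases hWdim with h | ⟨h, hroot⟩
      · exact eigenvalueHeight_mul_min_le_of_finrank_eq_one h Q _ hA hB
      · exact eigenvalueHeight_mul_min_le_of_finrank_eq_two h Q hroot _ hA hB
    have hblock := eigenvalueHeight_blockTriangular_mul_le P S Q _ _ hPK hQK
      (hK.image L.continuous)
    rw [← hR, LinearMap.eigenvalueHeight_conj] at hblock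
    obtain ⟨c, hc⟩ := L.exists_addHaar_eq_mul_image μ
      ((Measure.addHaar : Measure V).prod (Measure.addHaar : Measure W))
    have himg : L '' (K + T '' K) = L '' K + R '' (L '' K) := by
      rw [Set.image_add, ← Set.image_comp, ← Set.image_comp]
      congr 1
      refine Set.image_congr fun x _ => ?_
      simp [R, L, LinearEquiv.conj_apply]
    rw [hc, hc, himg, mul_left_comm]
    gcongr

theorem theorem2 (d : ℕ) (T : EuclideanSpace ℝ (Fin d) →ₗ[ℝ] EuclideanSpace ℝ (Fin d))
    (K : Set (EuclideanSpace ℝ (Fin d))) :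
    innerMeasure volume (K + T '' K) ≥
      ENNReal.ofReal (eigenvalueHeight T) * innerMeasure volume K := by
  simp only [innerMeasure, ENNReal.mul_iSup, ge_iff_le]
  refine iSup₂_le fun B hBK => iSup_le fun hB => ?_
  rw [hB.measure_eq_iSup_isCompact]
  simp only [ENNReal.mul_iSup]
  refine iSup₂_le fun C hCB => iSup_le fun hC => ?_
  have hsub : C + T '' C ⊆ K + T '' K :=
    Set.add_subset_add (hCB.trans hBK) (Set.image_mono (hCB.trans hBK))
  -- Compactness of `C` makes the sumset measurable, hence a competitor in the supremum.
  have hmeas : MeasurableSet (C + T '' C) :=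
    (hC.add (hC.image T.continuous_of_finiteDimensional)).measurableSet
  exact (hC.eigenvalueHeight_mul_addHaar_le T volume).trans
    (le_iSup₂_of_le (C + T '' C) hsub (le_iSup_of_le hmeas le_rfl))
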